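/- Fix an o-minimal structure over $\mathbb R$ (the order $<$ is definable, and every definable subset of $\mathbb R$ is a finite union of points and intervals; definable means definable with parameters). All sets and maps below are assumed definable in it, and the empty set is regarded as connected. **Semi-monotone sets.** A coordinate cone in $\mathbb R^n$ is a set $\{x : x_j\,\sigma_j\,c_j \text{ for all } j\in J\}$ with $J\subset\{1,\dots,n\}$, $\sigma_j\in\{<,=,>\}$, $c_j\in\mathbb R$. An open bounded set $X\subset\mathbb R^n$ is *semi-monotone* if $X\cap C$ is connected for every coordinate cone $C$. **Monotone functions.** A function $f$ on $X\subset\mathbb R^n$ is *independent of* $x_j$ if $f(x)=f(y)$ whenever $x,y\in X$ differ only in the $j$-th coordinate; it is *strictly increasing* (resp. *strictly decreasing*) *in* $x_j$ if $f(x)<f(y)$ (resp. $f(x)>f(y)$) whenever $x,y\in X$ differ only in the $j$-th coordinate and $x_j<y_j$. A bounded upper semi-continuous function $f$ on a non-empty semi-monotone set $X$ is *submonotone* if $\{x\in X: f(x)<b\}$ is semi-monotone for every $b\in\mathbb R$, and $f$ is *supermonotone* if $-f$ is submonotone. A function on a non-empty semi-monotone set is *monotone* if it is both submonotone and supermonotone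 and, for each $j$, it is strictly increasing in, strictly decreasing in, or independent of $x_j$. **Basis sets.** Let $n,k\ge 1$, let $X\subset\mathbb R^n$ be non-empty and semi-monotone, and let $\mathbf f=(f_1,\dots,f_k):X\to\mathbb R^k$ be a bounded continuous map with graph $\mathbf F\subset\mathbb R^{n+k}$, the coordinates of $\mathbb R^{n+k}$ being $x_1,\dots,x_n,y_1,\dots,y_k$. A set $H=\{x_{j_1},\dots,x_{j_\alpha},y_{i_1},\dots,y_{i_\beta}\}$ of $\alpha+\beta=n$ distinct coordinates is a *basis set* of $\mathbf f$ if the map $(x_{j_1},\dots,x_{j_\alpha},f_{i_1},\dots,f_{i_\beta}):X\to\mathbb R^n$ is injective. **Monotone maps.** Such a map $\mathbf f$ is defined to be *monotone* by induction on $n$. If $n=1$, it is monotone if every $f_i$ is a monotone function. If $n\ge 2$, it is monotone if for all $i\in\{1,\dots,k\}$ and $j\in\{1,\dots,n\}$ such that $f_i$ is not independent of $x_j$ the following holds: (i) for every $b\in\mathbb R$ the set $\mathbf F\cap\{y_i=b\}$, when non-empty, considered as a set in the space of the coordinates other than $y_i$, is the graph of a monotone map $\mathbf f_{i,j,b}$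 from a non-empty semi-monotone subset of $\mathrm{span}\{x_1,\dots,x_{j-1},x_{j+1},\dots,x_n\}$ to $\mathrm{span}\{y_1,\dots,y_{i-1},x_j,y_{i+1},\dots,y_k\}$; (ii) the system of basis sets of $\mathbf f_{i,j,b}$ is the same for all $b\in\mathbb R$ such that $\mathbf F\cap\{y_i=b\}\neq\emptyset$. **Theorem.** Every monotone map $\mathbf f:X\to\mathbb R^k$ is *quasi-affine*. That is, it is a bounded continuous map on a non-empty bounded open set $X\subset\mathbb R^n$ such that for every choice of $n$ distinct coordinates $x_{j_1},\dots,x_{j_\alpha},y_{i_1},\dots,y_{i_\beta}$, $\alpha+\beta=n$, with span $T$, the projection $\rho_T:\mathbf F\to T$ of the graph $\mathbf F$ of $\mathbf f$ is injective if and only if its image $\rho_T(\mathbf F)$ is $n$-dimensional. (The dimension of a non-empty definable set is the largest $d$ such that its projection to the span of some $d$ of the coordinates has non-empty interior.) -/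

import Mathlib

open Set

universe u v

namespace MonotoneMaps

/-- The structure `L` on the real line is o-minimal: the order relation is definable, and every
subset of `ℝ` definable (with parameters) is a finite union of points and intervals. (The intervals
of `ℝ`, bounded or not, one-point sets included, are precisely the order-connected sets.) -/
def IsOMinimal (L : FirstOrder.Language.{u, v}) [L.Structure ℝ] : Prop :=
  (univ : Set ℝ).Definable L {x : Fin 2 → ℝ | x 0 < x 1} ∧
    ∀ A : Set ℝ, (univ : Set ℝ).Definable₁ L A →
      ∃ 𝓘 : Set (Set ℝ), 𝓘.Finite ∧ (∀ I ∈ 𝓘, I.OrdConnected) ∧ A = ⋃₀ 𝓘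

/-- The coordinate cone `{x | x j (σ j) (c j) for all j ∈ J}`, where each `σ j` is one of
`<`, `=`, `>`. -/
def coordinateCone {ι : Type*} (J : Finset ι) (σ : ι → Ordering) (c : ι → ℝ) : Set (ι → ℝ) :=
  {x | ∀ j ∈ J, (σ j).Compares (x j) (c j)}

/-- Semi-monotone sets: definable bounded open sets whose intersection with every coordinate cone
is connected, the empty set being regarded as connected. -/
structure IsSemiMonotone (L : FirstOrder.Language.{u, v}) [L.Structure ℝ] {n : ℕ}
    (X : Set (Fin n → ℝ)) :
    Prop where
  definable : (univ : Set ℝ).Definable L X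
  isOpen : IsOpen X
  isBounded : Bornology.IsBounded X
  isPreconnected : ∀ (J : Finset (Fin n)) (σ : Fin n → Ordering) (c : Fin n → ℝ),
    IsPreconnected (X ∩ coordinateCone J σ c)

/-- The graph over `X` of a map `f`. The coordinates of the ambient space are labelled by
`ι ⊕ κ`: `Sum.inl j` is the label of `x_j` and `Sum.inr i` is the label of `y_i`. -/
def mapGraph {ι κ : Type*} (X : Set (ι → ℝ)) (f : (ι → ℝ) → (κ → ℝ)) : Set (ι ⊕ κ → ℝ) :=
  (fun x => Sum.elim x (f x)) '' X

/-- The map `f` on `X` is definable, i.e. its graph is. -/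
def IsDefinableMap (L : FirstOrder.Language.{u, v}) [L.Structure ℝ] {ι κ : Type*} (X : Set (ι → ℝ))
    (f : (ι → ℝ) → (κ → ℝ)) : Prop :=
  (univ : Set ℝ).Definable L (mapGraph X f)

/-- `f` is strictly increasing in the coordinate `x_j` on `X`. -/
def StrictIncreasingIn {n : ℕ} (X : Set (Fin n → ℝ)) (f : (Fin n → ℝ) → ℝ) (j : Fin n) : Prop :=
  ∀ x ∈ X, ∀ y ∈ X, (∀ l, l ≠ j → x l = y l) → x j < y j → f x < f y

/-- `f` is strictly decreasing in the coordinate `x_j` on `X`. -/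
def StrictDecreasingIn {n : ℕ} (X : Set (Fin n → ℝ)) (f : (Fin n → ℝ) → ℝ) (j : Fin n) : Prop :=
  ∀ x ∈ X, ∀ y ∈ X, (∀ l, l ≠ j → x l = y l) → x j < y j → f y < f x

/-- `f` is independent of the coordinate `x_j` on `X`. -/
def IndependentOf {n : ℕ} (X : Set (Fin n → ℝ)) (f : (Fin n → ℝ) → ℝ) (j : Fin n) : Prop :=
  ∀ x ∈ X, ∀ y ∈ X, (∀ l, l ≠ j → x l = y l) → f x = f y

/-- Submonotone functions: bounded upper semi-continuous definable functions on a non-empty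
semi-monotone set, all of whose strict sublevel sets are semi-monotone. -/
structure IsSubmonotone (L : FirstOrder.Language.{u, v}) [L.Structure ℝ] {n : ℕ}
    (X : Set (Fin n → ℝ))
    (f : (Fin n → ℝ) → ℝ) : Prop where
  nonempty : X.Nonempty
  isSemiMonotone : IsSemiMonotone L X
  definable : IsDefinableMap L X (fun x (_ : Unit) => f x)
  isBounded : Bornology.IsBounded (f '' X)
  upperSemicontinuousOn : UpperSemicontinuousOn f X
  sublevel : ∀ b : ℝ, IsSemiMonotone L {x ∈ X | f x < b}

/-- Supermonotone functions. -/
def IsSupermonotone (L : FirstOrder.Language.{u, v}) [L.Structure ℝ] {n : ℕ} (X : Set (Fin n → ℝ))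
    (f : (Fin n → ℝ) → ℝ) : Prop :=
  IsSubmonotone L X (fun x => -f x)

/-- Monotone functions. -/
structure IsMonotoneFunction (L : FirstOrder.Language.{u, v}) [L.Structure ℝ] {n : ℕ}
    (X : Set (Fin n → ℝ))
    (f : (Fin n → ℝ) → ℝ) : Prop where
  submonotone : IsSubmonotone L X f
  supermonotone : IsSupermonotone L X f
  coordinates : ∀ j, StrictIncreasingIn X f j ∨ StrictDecreasingIn X f j ∨ IndependentOf X f j

/-- The system of basis sets associated with `f` on `X`: those `n`-element sets `H` of coordinates
among `x_1, …, x_n, y_1, …, y_k` for which the map from `X` formed by the corresponding functions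
(`x_j` for `Sum.inl j`, and `f_i` for `Sum.inr i`) is injective. -/
def basisSets {n k : ℕ} (X : Set (Fin n → ℝ)) (f : (Fin n → ℝ) → (Fin k → ℝ)) :
    Set (Finset (Fin n ⊕ Fin k)) :=
  {H | H.card = n ∧ InjOn (fun x => H.restrict (Sum.elim x (f x))) X}

/-- The relabelling of coordinates when `y_i` is dropped and `x_j` is made a dependent variable:
the independent variables are the `x_l` with `l ≠ j` in their order, and the dependent variables
are `y_1, …, y_{i-1}, x_j, y_{i+1}, …, y_k`. -/
def fibreLabel {n k : ℕ} (i : Fin k) (j : Fin (n + 1)) : Fin n ⊕ Fin k → Fin (n + 1) ⊕ Fin k :=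
  Sum.elim (fun l => Sum.inl (j.succAbove l)) (fun m => if m = i then Sum.inl j else Sum.inr m)

/-- The intersection `F ∩ {y_i = b}`, considered as a subset of
`span {x_l : l ≠ j} × span {y_1, …, y_{i-1}, x_j, y_{i+1}, …, y_k}`. -/
def fibre {n k : ℕ} (F : Set (Fin (n + 1) ⊕ Fin k → ℝ)) (i : Fin k) (j : Fin (n + 1)) (b : ℝ) :
    Set (Fin n ⊕ Fin k → ℝ) :=
  (fun z => z ∘ fibreLabel i j) '' {z ∈ F | z (Sum.inr i) = b}

/-- Continuous, bounded, definable maps on a non-empty semi-monotone set. -/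
structure IsAdmissibleMap (L : FirstOrder.Language.{u, v}) [L.Structure ℝ] {n k : ℕ}
    (X : Set (Fin n → ℝ))
    (f : (Fin n → ℝ) → (Fin k → ℝ)) : Prop where
  nonempty : X.Nonempty
  isSemiMonotone : IsSemiMonotone L X
  definable : IsDefinableMap L X f
  continuousOn : ContinuousOn f X
  isBounded : Bornology.IsBounded (f '' X)

/-- Monotone maps, by induction on `n ≥ 1` (there are none for `n = 0`). For `n ≥ 2`, whenever `f_i`
is not independent of `x_j`, each non-empty `F ∩ {y_i = b}` is the graph of a monotone map
`f_{i,j,b}` in the variables `x_l`, `l ≠ j`, and the system `𝓜` of basis sets of `f_{i,j,b}`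
does not depend on `b`. -/
def IsMonotoneMap (L : FirstOrder.Language.{u, v}) [L.Structure ℝ] {k : ℕ} :
    (n : ℕ) → (X : Set (Fin n → ℝ)) → (f : (Fin n → ℝ) → (Fin k → ℝ)) → Prop
  | 0, _, _ => False
  | 1, X, f => IsAdmissibleMap L X f ∧ ∀ i, IsMonotoneFunction L X (fun x => f x i)
  | n + 2, X, f => IsAdmissibleMap L X f ∧
      ∀ (i : Fin k) (j : Fin (n + 2)), ¬ IndependentOf X (fun x => f x i) j →
        ∃ 𝓜 : Set (Finset (Fin (n + 1) ⊕ Fin k)),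
          ∀ b : ℝ, (fibre (mapGraph X f) i j b).Nonempty →
            ∃ (Y : Set (Fin (n + 1) → ℝ)) (g : (Fin (n + 1) → ℝ) → (Fin k → ℝ)),
              IsMonotoneMap L (n + 1) Y g ∧ fibre (mapGraph X f) i j b = mapGraph Y g ∧
                basisSets Y g = 𝓜

open Classical in
/-- The dimension of a set definable in an o-minimal structure: the largest number of coordinates
such that the projection of the set to their span has non-empty interior; it is `⊥` for the empty
set. -/
noncomputable def definableDim {ι : Type*} [Fintype ι] (A : Set (ι → ℝ)) : WithBot ℕ :=
  (Finset.univ.filter fun J : Finset ι => (interior (J.restrict '' A)).Nonempty).sup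
    fun J => (J.card : WithBot ℕ)

/-- Quasi-affine maps: bounded continuous maps on a non-empty bounded open set such that, for every
set `H` of `n` coordinates among `x_1, …, x_n, y_1, …, y_k`, the projection of the graph to the span
of `H` is injective if and only if its image is `n`-dimensional. -/
structure IsQuasiAffine {n k : ℕ} (X : Set (Fin n → ℝ)) (f : (Fin n → ℝ) → (Fin k → ℝ)) :
    Prop where
  nonempty : X.Nonempty
  isOpen : IsOpen X
  isBounded_domain : Bornology.IsBounded X
  continuousOn : ContinuousOn f X
  isBounded : Bornology.IsBounded (f '' X)
  injOn_iff : ∀ H : Finset (Fin n ⊕ Fin k), H.card = n →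
    (InjOn H.restrict (mapGraph X f) ↔ definableDim (H.restrict '' mapGraph X f) = (n : WithBot ℕ))

end MonotoneMaps

open Filter Topology

/-! ### Baire category and local constancy. -/

section Topology

/-! Being `n`-dimensional in an `n`-dimensional span means having interior, so for each `H`
injectivity of the projection is compared with its image having interior, by induction on `n`. If
every `f_i` with `y_i` in `H` is independent of all `x_j`, these `f_i` are constant and the claim is
immediate. Otherwise some such `f_i` depends on some `x_j`, and the graph is sliced by `y_i = b`.
The projection is injective iff it is so on every slice (`injOn_restrict_iff_forall_fibre`), and
slices of the image are projections of the fibres (`slice_splitCoord_image`), to which induction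
applies. If the projection is injective, the image has fat slices over an interval of `b`; being
σ-compact, it has interior by Baire (`IsSigmaCompact.interior_nonempty_of_slices`). Conversely,
interior gives one fat slice, hence one injective fibre, and condition (ii) carries injectivity to
all fibres. -/

theorem exists_interior_inter_nonempty_of_subset_iUnion {α ι : Type*} [TopologicalSpace α]
    [BaireSpace α] [Countable ι] {U : Set α} (hU : IsOpen U) (hne : U.Nonempty) {K : ι → Set α}
    (hK : ∀ i, IsClosed (K i)) (hUK : U ⊆ ⋃ i, K i) : ∃ i, (interior (K i) ∩ U).Nonempty := by
  -- Adjoining `Uᶜ` (index `none`) makes the closed sets cover the whole space.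
  have hd : Dense (⋃ o : Option ι, interior (o.elim Uᶜ K)) := by
    refine dense_iUnion_interior_of_closed ?_ ?_
    · rintro (_ | i)
      exacts [hU.isClosed_compl, hK i]
    · refine eq_univ_of_forall fun x => mem_iUnion.2 ?_
      by_cases hx : x ∈ U
      · obtain ⟨i, hi⟩ := mem_iUnion.1 (hUK hx)
        exact ⟨some i, hi⟩
      · exact ⟨none, hx⟩
  obtain ⟨x, hxU, hx⟩ := hd.inter_open_nonempty U hU hne
  obtain ⟨_ | i, hi⟩ := mem_iUnion.1 hx
  · exact absurd hxU (interior_subset hi)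
  · exact ⟨i, x, hi, hxU⟩

/-- A σ-compact subset of a product has non-empty interior as soon as its slices over a non-empty
open set have. -/
theorem IsSigmaCompact.interior_nonempty_of_slices {α β : Type*} [TopologicalSpace α]
    [TopologicalSpace β] [T2Space α] [T2Space β] [BaireSpace α] [BaireSpace β]
    [SecondCountableTopology β] {A : Set (α × β)} (hA : IsSigmaCompact A) {I : Set α}
    (hI : IsOpen I) (hIne : I.Nonempty)
    (h : ∀ a ∈ I, (interior {y | (a, y) ∈ A}).Nonempty) : (interior A).Nonempty := by
  obtain ⟨K, hK, rfl⟩ := hA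
  -- Baire in the base: for each compact piece and basic open `V`, the `a` whose slice of that piece
  -- contains `V` form a closed set. A second use of Baire, inside each slice, shows that these sets
  -- cover `I`.
  obtain ⟨⟨m, V⟩, a, ha, -⟩ := exists_interior_inter_nonempty_of_subset_iUnion hI hIne
    (K := fun p : ℕ × TopologicalSpace.countableBasis β =>
      {a | ∀ y ∈ (p.2 : Set β), (a, y) ∈ K p.1})
    (fun p => by
      simp only [ofPred_forall]
      exact isClosed_biInter fun y _ =>
        (hK p.1).isClosed.preimage (Continuous.prodMk_left y))
    (fun a ha => by
      obtain ⟨m, y, hy, -⟩ := exists_interior_inter_nonempty_of_subset_iUnion isOpen_interior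
        (h a ha) (K := fun m => {y | (a, y) ∈ K m})
        (fun m => (hK m).isClosed.preimage (Continuous.prodMk_right a))
        (fun y hy => by simpa using interior_subset hy)
      obtain ⟨V, hV, -, hVK⟩ := (TopologicalSpace.isBasis_countableBasis β).exists_subset_of_mem_open
        hy isOpen_interior
      exact mem_iUnion.2 ⟨(m, ⟨V, hV⟩), fun z hz => by
        have hz' : z ∈ {y | (a, y) ∈ K m} := interior_subset (hVK hz)
        exact hz'⟩)
  obtain ⟨y, hy⟩ : (V : Set β).Nonempty := TopologicalSpace.nonempty_of_mem_countableBasis V.2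
  refine ⟨(a, y), mem_interior.2 ⟨_, ?_, isOpen_interior.prod
    (TopologicalSpace.isOpen_of_mem_countableBasis V.2), ha, hy⟩⟩
  rintro ⟨a', y'⟩ ⟨ha', hy'⟩
  exact mem_iUnion.2 ⟨m, interior_subset ha' y' hy'⟩

/-- Local constancy is continuity for the discrete topology on `β`. -/
theorem IsPreconnected.eq_of_eventually_eq {α β : Type*} [TopologicalSpace α] {s : Set α}
    (hs : IsPreconnected s) {f : α → β} (h : ∀ x ∈ s, ∀ᶠ y in 𝓝[s] x, f y = f x) {x y : α}
    (hx : x ∈ s) (hy : y ∈ s) : f x = f y := by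
  let _ : TopologicalSpace β := ⊥
  have : DiscreteTopology β := ⟨rfl⟩
  refine hs.constant (f := f) (fun z hz => ?_) hx hy
  exact tendsto_nhds_of_eventually_eq (h z hz)

theorem IsOpen.isSigmaCompact_of_secondCountable {α : Type*} [TopologicalSpace α] [T2Space α]
    [LocallyCompactSpace α] [SecondCountableTopology α] {U : Set α} (hU : IsOpen U) :
    IsSigmaCompact U := by
  have := hU.locallyCompactSpace
  exact isSigmaCompact_iff_sigmaCompactSpace.2 inferInstance

theorem Homeomorph.interior_image_nonempty {α β : Type*} [TopologicalSpace α] [TopologicalSpace β]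
    (e : α ≃ₜ β) {s : Set α} : (interior (e '' s)).Nonempty ↔ (interior s).Nonempty := by
  rw [← e.image_interior, image_nonempty]

end Topology

/-! ### Dimension, and dependence on single coordinates. -/

namespace MonotoneMaps

/-- Only the full set of coordinates has the maximal cardinality, and projecting to it is a
homeomorphism. -/
theorem definableDim_eq_card_iff {ι : Type*} [Fintype ι] [Nonempty ι] (A : Set (ι → ℝ)) :
    definableDim A = (Fintype.card ι : WithBot ℕ) ↔ (interior A).Nonempty := by
  classical
  have key : (interior ((Finset.univ : Finset ι).restrict '' A)).Nonempty ↔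
      (interior A).Nonempty :=
    Homeomorph.interior_image_nonempty
      (Homeomorph.piCongrLeft (Y := fun _ => ℝ)
        (Equiv.subtypeUnivEquiv (p := (· ∈ (Finset.univ : Finset ι))) Finset.mem_univ)).symm
  rw [← key, definableDim]
  constructor
  · intro h
    by_contra hne
    refine h.not_lt ?_
    rw [Finset.sup_lt_iff (WithBot.bot_lt_coe _)]
    intro J hJ
    refine WithBot.coe_lt_coe.2 ((Finset.card_lt_iff_ne_univ _).2 ?_)
    rintro rfl
    exact hne (Finset.mem_filter.1 hJ).2
  · intro h
    refine le_antisymm (Finset.sup_le fun J _ => WithBot.coe_le_coe.2 (Finset.card_le_univ J)) ?_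
    exact Finset.le_sup (f := fun J : Finset ι => (J.card : WithBot ℕ)) (b := Finset.univ)
      (Finset.mem_filter.2 ⟨Finset.mem_univ _, h⟩)

theorem continuous_restrict {ι : Type*} (H : Finset ι) :
    Continuous (H.restrict : (ι → ℝ) → _) :=
  continuous_pi fun h => continuous_apply (h : ι)

theorem injOn_restrict_mapGraph_iff {ι κ : Type*} {X : Set (ι → ℝ)} {f : (ι → ℝ) → (κ → ℝ)}
    (H : Finset (ι ⊕ κ)) :
    InjOn H.restrict (mapGraph X f) ↔ InjOn (fun x => H.restrict (Sum.elim x (f x))) X := by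
  constructor
  · intro h
    exact h.comp (fun x _ y _ hxy => funext fun l => congrFun hxy (Sum.inl l))
      (mapsTo_image _ _)
  · intro h
    exact h.image_of_comp

theorem IsSemiMonotone.isPreconnected_self {L : FirstOrder.Language.{u, v}} [L.Structure ℝ] {n : ℕ}
    {X : Set (Fin n → ℝ)} (hX : IsSemiMonotone L X) : IsPreconnected X := by
  simpa [coordinateCone] using hX.isPreconnected ∅ (fun _ => .lt) 0

theorem eq_of_forall_independentOf {n : ℕ} {X : Set (Fin n → ℝ)} (hXo : IsOpen X)
    (hXc : IsPreconnected X) {g : (Fin n → ℝ) → ℝ} (h : ∀ j, IndependentOf X g j)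
    {x y : Fin n → ℝ} (hx : x ∈ X) (hy : y ∈ X) : g x = g y := by
  refine hXc.eq_of_eventually_eq (fun x hx => mem_nhdsWithin_of_mem_nhds ?_) hx hy
  obtain ⟨ε, hε, hball⟩ := Metric.isOpen_iff.1 hXo x hx
  filter_upwards [Metric.ball_mem_nhds x hε] with y hy
  -- A sup-norm ball is a box, so coordinates of `x` can be replaced by those of `y` one at a time
  -- without leaving `X`.
  have hmem (s : Finset (Fin n)) : s.piecewise y x ∈ X := by
    refine hball ((dist_pi_lt_iff hε).2 fun l => ?_)
    by_cases hl : l ∈ s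
    · simpa [hl] using (dist_pi_lt_iff hε).1 hy l
    · simpa [hl] using hε
  have key (s : Finset (Fin n)) : g (s.piecewise y x) = g x := by
    induction s using Finset.induction_on with
    | empty => simp
    | insert j s hj ih =>
      rw [← ih]
      refine h j _ (hmem _) _ (hmem _) fun l hl => ?_
      simp [Finset.piecewise, hl]
  simpa using key Finset.univ

/-- If the dependent coordinates in `H` are independent of all `x_j`, then the projection of the
graph to the span of `H` is injective, or has an image with non-empty interior, only if `H`
consists of all the `x_j`. -/
theorem injOn_restrict_iff_of_independentOf {n k : ℕ} {X : Set (Fin n → ℝ)}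
    {f : (Fin n → ℝ) → (Fin k → ℝ)} (hne : X.Nonempty) (hXo : IsOpen X) (hXc : IsPreconnected X)
    {H : Finset (Fin n ⊕ Fin k)} (hH : H.card = n)
    (h : ∀ i, Sum.inr i ∈ H → ∀ j, IndependentOf X (fun x => f x i) j) :
    InjOn H.restrict (mapGraph X f) ↔ (interior (H.restrict '' mapGraph X f)).Nonempty := by
  rw [injOn_restrict_mapGraph_iff]
  by_cases hall : ∀ l, Sum.inl l ∈ H
  · have hHeq : H = Finset.univ.map Function.Embedding.inl := by
      refine (Finset.eq_of_subset_of_card_le ?_ ?_).symm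
      · intro a ha
        obtain ⟨l, -, rfl⟩ := Finset.mem_map.1 ha
        exact hall l
      · simp [hH]
    have himage : H.restrict '' mapGraph X f = (fun w l => w ⟨Sum.inl l, hall l⟩) ⁻¹' X := by
      ext w
      constructor
      · rintro ⟨_, ⟨x, hx, rfl⟩, rfl⟩
        exact hx
      · intro hw
        refine ⟨_, ⟨_, hw, rfl⟩, funext ?_⟩
        rintro ⟨a, ha⟩
        have ha' := ha
        rw [hHeq, Finset.mem_map] at ha'
        obtain ⟨l, -, rfl⟩ := ha'
        rfl
    refine iff_of_true (fun x _ y _ hxy => funext fun l => congrFun hxy ⟨Sum.inl l, hall l⟩) ?_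
    have hopen : IsOpen (H.restrict '' mapGraph X f) := by
      rw [himage]
      exact hXo.preimage (continuous_pi fun l => continuous_apply _)
    rw [hopen.interior_eq]
    exact (hne.image _).image _
  · push Not at hall
    obtain ⟨l, hl⟩ := hall
    have hinr : ∃ i, Sum.inr i ∈ H := by
      by_contra! hnone
      have hsub : H ⊆ (Finset.univ.erase l).map Function.Embedding.inl := by
        rintro (m | i) ha
        · refine Finset.mem_map.2 ⟨m, Finset.mem_erase.2 ⟨?_, Finset.mem_univ _⟩, rfl⟩
          rintro rfl
          exact hl ha
        · exact absurd ha (hnone i)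
      have hcard := Finset.card_le_card hsub
      have hpos : 0 < n := l.pos
      simp only [Finset.card_map, Finset.card_erase_of_mem (Finset.mem_univ l), Finset.card_univ,
        Fintype.card_fin, hH] at hcard
      omega
    obtain ⟨x, hx⟩ := hne
    refine iff_of_false (fun hinj => ?_) ?_
    · have hc : Tendsto (fun t => Function.update x l t) (𝓝[≠] (x l)) (𝓝 x) := by
        have : Continuous fun t => Function.update x l t := continuous_const.update l continuous_id
        simpa using (this.tendsto (x l)).mono_left nhdsWithin_le_nhds
      obtain ⟨t, ht, htne⟩ :=
        ((hc.eventually (hXo.mem_nhds hx)).and self_mem_nhdsWithin).exists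
      have heq := hinj ht hx <| funext <| by
        rintro ⟨m | i, ha⟩
        · have : m ≠ l := by
            rintro rfl
            exact hl ha
          simp [this]
        · exact h i ha l _ ht _ hx fun m hm => by simp [hm]
      exact htne (by simpa using congrFun heq l)
    · obtain ⟨i, hi⟩ := hinr
      -- As `f_i` is constant, the image lies in a hyperplane.
      have hsub : H.restrict '' mapGraph X f ⊆ (fun w => w ⟨Sum.inr i, hi⟩) ⁻¹' {f x i} := by
        rintro _ ⟨_, ⟨y, hy, rfl⟩, rfl⟩
        exact eq_of_forall_independentOf hXo hXc (h i hi) hy hx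
      have hint := interior_mono hsub
      rw [← (isOpenMap_eval (X := fun _ : H => ℝ) ⟨Sum.inr i, hi⟩).preimage_interior_eq_interior_preimage
        (continuous_apply _), interior_singleton, preimage_empty] at hint
      exact not_nonempty_iff_eq_empty.2 (subset_empty_iff.1 hint)

/-- A function depending on some coordinate takes all values in some non-empty open interval. -/
theorem exists_Ioo_subset_image {n : ℕ} {X : Set (Fin n → ℝ)} (hXc : IsPreconnected X)
    {g : (Fin n → ℝ) → ℝ} (hg : ContinuousOn g X) {j : Fin n} (h : ¬ IndependentOf X g j) :
    ∃ a b, a < b ∧ Ioo a b ⊆ g '' X := by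
  unfold IndependentOf at h
  push Not at h
  obtain ⟨x, hx, y, hy, -, hxy⟩ := h
  have hord := (hXc.image g hg).ordConnected
  rcases hxy.lt_or_gt with hlt | hlt
  · exact ⟨_, _, hlt, Ioo_subset_Icc_self.trans
      (hord.out (mem_image_of_mem g hx) (mem_image_of_mem g hy))⟩
  · exact ⟨_, _, hlt, Ioo_subset_Icc_self.trans
      (hord.out (mem_image_of_mem g hy) (mem_image_of_mem g hx))⟩

/-! ### Slicing the graph by `y_i = b`. -/

theorem fibreLabel_ne {n k : ℕ} (i : Fin k) (j : Fin (n + 1)) (a : Fin n ⊕ Fin k) :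
    fibreLabel i j a ≠ Sum.inr i := by
  rcases a with l | m
  · simp [fibreLabel]
  · by_cases hm : m = i <;> simp [fibreLabel, hm]

theorem fibreLabel_injective {n k : ℕ} (i : Fin k) (j : Fin (n + 1)) :
    Function.Injective (fibreLabel i j) := by
  rintro (l | m) (l' | m') h
  · simpa [fibreLabel] using h
  · by_cases hm : m' = i <;> simp [fibreLabel, hm, Fin.succAbove_ne] at h
  · by_cases hm : m = i <;> simp [fibreLabel, hm, (Fin.succAbove_ne _ _).symm] at h
  · by_cases hm : m = i <;> by_cases hm' : m' = i <;> simp_all [fibreLabel]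

theorem exists_fibreLabel_eq {n k : ℕ} (i : Fin k) (j : Fin (n + 1)) {a : Fin (n + 1) ⊕ Fin k}
    (ha : a ≠ Sum.inr i) : ∃ b, fibreLabel i j b = a := by
  rcases a with l | m
  · by_cases hl : l = j
    · exact ⟨Sum.inr i, by simp [fibreLabel, hl]⟩
    · obtain ⟨l', rfl⟩ := Fin.exists_succAbove_eq hl
      exact ⟨Sum.inl l', rfl⟩
  · have : m ≠ i := fun h => ha (h ▸ rfl)
    exact ⟨Sum.inr m, by simp [fibreLabel, this]⟩

/-- The set of coordinates other than `y_i` in `H`, in the labelling of the fibres. -/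
noncomputable def fibreCoords {n k : ℕ} (i : Fin k) (j : Fin (n + 1))
    (H : Finset (Fin (n + 1) ⊕ Fin k)) : Finset (Fin n ⊕ Fin k) :=
  H.preimage (fibreLabel i j) (fibreLabel_injective i j).injOn

theorem card_fibreCoords {n k : ℕ} {i : Fin k} (j : Fin (n + 1))
    {H : Finset (Fin (n + 1) ⊕ Fin k)} (hi : Sum.inr i ∈ H) :
    (fibreCoords i j H).card + 1 = H.card := by
  classical
  have himage : (fibreCoords i j H).image (fibreLabel i j) = H.erase (Sum.inr i) := by
    ext a
    simp only [fibreCoords, Finset.mem_image, Finset.mem_preimage, Finset.mem_erase]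
    constructor
    · rintro ⟨b, hb, rfl⟩
      exact ⟨fibreLabel_ne i j b, hb⟩
    · rintro ⟨hne, ha⟩
      obtain ⟨b, rfl⟩ := exists_fibreLabel_eq i j hne
      exact ⟨b, ha, rfl⟩
  rw [← Finset.card_image_of_injective _ (fibreLabel_injective i j), himage,
    Finset.card_erase_add_one hi]

noncomputable def fibreCoordsEquiv {n k : ℕ} {i : Fin k} (j : Fin (n + 1))
    {H : Finset (Fin (n + 1) ⊕ Fin k)} (hi : Sum.inr i ∈ H) :
    fibreCoords i j H ≃ {h : H // h ≠ ⟨Sum.inr i, hi⟩} :=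
  Equiv.ofBijective
    (fun a => ⟨⟨fibreLabel i j a, Finset.mem_preimage.1 a.2⟩,
      fun h => fibreLabel_ne i j a (congrArg Subtype.val h)⟩) <| by
    constructor
    · intro a b hab
      exact Subtype.ext (fibreLabel_injective i j
        (congrArg (fun c : {h : H // h ≠ ⟨Sum.inr i, hi⟩} => (c : H).1) hab))
    · rintro ⟨⟨a, ha⟩, hne⟩
      obtain ⟨b, rfl⟩ := exists_fibreLabel_eq i j fun h => hne (Subtype.ext h)
      exact ⟨⟨b, Finset.mem_preimage.2 ha⟩, rfl⟩

/-- Splitting off the coordinate `y_i` from the span of `H`. -/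
noncomputable def splitCoord {n k : ℕ} {i : Fin k} (j : Fin (n + 1))
    {H : Finset (Fin (n + 1) ⊕ Fin k)} (hi : Sum.inr i ∈ H) :
    (H → ℝ) ≃ₜ ℝ × (fibreCoords i j H → ℝ) :=
  open Classical in
  (Homeomorph.funSplitAt ℝ (⟨Sum.inr i, hi⟩ : H)).trans
    ((Homeomorph.refl ℝ).prodCongr
      (Homeomorph.piCongrLeft (Y := fun _ => ℝ) (fibreCoordsEquiv j hi)).symm)

theorem splitCoord_restrict {n k : ℕ} {i : Fin k} (j : Fin (n + 1))
    {H : Finset (Fin (n + 1) ⊕ Fin k)} (hi : Sum.inr i ∈ H) (z : Fin (n + 1) ⊕ Fin k → ℝ) :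
    splitCoord j hi (H.restrict z) =
      (z (Sum.inr i), (fibreCoords i j H).restrict (z ∘ fibreLabel i j)) :=
  rfl

theorem slice_splitCoord_image {n k : ℕ} {i : Fin k} (j : Fin (n + 1))
    {H : Finset (Fin (n + 1) ⊕ Fin k)} (hi : Sum.inr i ∈ H)
    (F : Set (Fin (n + 1) ⊕ Fin k → ℝ)) (b : ℝ) :
    {w | (b, w) ∈ splitCoord j hi '' (H.restrict '' F)} =
      (fibreCoords i j H).restrict '' fibre F i j b := by
  ext w
  constructor
  · rintro ⟨_, ⟨z, hz, rfl⟩, hzw⟩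
    rw [splitCoord_restrict, Prod.mk.injEq] at hzw
    exact ⟨_, ⟨z, ⟨hz, hzw.1⟩, rfl⟩, hzw.2⟩
  · rintro ⟨_, ⟨z, ⟨hz, rfl⟩, rfl⟩, rfl⟩
    exact ⟨_, ⟨z, hz, rfl⟩, splitCoord_restrict j hi z⟩

/-- Since `y_i` is in `H`, points with equal projections lie in the same fibre, where the remaining
coordinates determine the point. -/
theorem injOn_restrict_iff_forall_fibre {n k : ℕ} {i : Fin k} (j : Fin (n + 1))
    {H : Finset (Fin (n + 1) ⊕ Fin k)} (hi : Sum.inr i ∈ H)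
    (F : Set (Fin (n + 1) ⊕ Fin k → ℝ)) :
    InjOn H.restrict F ↔
      ∀ b, InjOn (fibreCoords i j H).restrict (fibre F i j b) := by
  constructor
  · rintro h b _ ⟨z, ⟨hz, rfl⟩, rfl⟩ _ ⟨z', ⟨hz', hzz'⟩, rfl⟩ heq
    rw [h hz hz' ((splitCoord j hi).injective ?_)]
    rw [splitCoord_restrict, splitCoord_restrict, hzz']
    exact congrArg _ heq
  · intro h z hz z' hz' heq
    have hs := congrArg (splitCoord j hi) heq
    rw [splitCoord_restrict, splitCoord_restrict, Prod.mk.injEq] at hs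
    have hcomp := h _ ⟨z, ⟨hz, rfl⟩, rfl⟩ ⟨z', ⟨hz', hs.1.symm⟩, rfl⟩ hs.2
    funext a
    by_cases ha : a = Sum.inr i
    · rw [ha]
      exact hs.1
    · obtain ⟨b, rfl⟩ := exists_fibreLabel_eq i j ha
      exact congrFun hcomp b

theorem fibre_mapGraph_nonempty {n k : ℕ} {X : Set (Fin (n + 1) → ℝ)}
    {f : (Fin (n + 1) → ℝ) → (Fin k → ℝ)} {i : Fin k} (j : Fin (n + 1)) {b : ℝ}
    (hb : b ∈ (fun x => f x i) '' X) : (fibre (mapGraph X f) i j b).Nonempty := by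
  obtain ⟨x, hx, rfl⟩ := hb
  exact ⟨_, _, ⟨⟨x, hx, rfl⟩, rfl⟩, rfl⟩

/-! ### The induction on `n`. -/

theorem IsAdmissibleMap.isSigmaCompact_mapGraph {L : FirstOrder.Language.{u, v}} [L.Structure ℝ]
    {n k : ℕ} {X : Set (Fin n → ℝ)} {f : (Fin n → ℝ) → (Fin k → ℝ)} (hf : IsAdmissibleMap L X f) :
    IsSigmaCompact (mapGraph X f) := by
  refine hf.isSemiMonotone.isOpen.isSigmaCompact_of_secondCountable.image_of_continuousOn ?_
  refine continuousOn_pi.2 ?_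
  rintro (l | i)
  · exact (continuous_apply l).continuousOn
  · exact continuousOn_pi.1 hf.continuousOn i

/-- Base case, where both sides hold: `H` is just `y_i`, and `f_i` is strictly monotone with an
interval in its image. -/
theorem injOn_restrict_iff_of_isMonotoneFunction {L : FirstOrder.Language.{u, v}} [L.Structure ℝ]
    {k : ℕ} {X : Set (Fin 1 → ℝ)} {f : (Fin 1 → ℝ) → (Fin k → ℝ)} (hf : IsAdmissibleMap L X f)
    {i : Fin k} (hfi : IsMonotoneFunction L X (fun x => f x i)) {j : Fin 1}
    (hij : ¬ IndependentOf X (fun x => f x i) j) {H : Finset (Fin 1 ⊕ Fin k)} (hH : H.card = 1)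
    (hi : Sum.inr i ∈ H) :
    InjOn H.restrict (mapGraph X f) ↔ (interior (H.restrict '' mapGraph X f)).Nonempty := by
  obtain rfl : H = {Sum.inr i} := by
    obtain ⟨a, rfl⟩ := Finset.card_eq_one.1 hH
    rw [Finset.mem_singleton.1 hi]
  rw [injOn_restrict_mapGraph_iff]
  refine iff_of_true (fun x hx y hy hxy => ?_) ?_
  · have hval : f x i = f y i := congrFun hxy ⟨Sum.inr i, hi⟩
    have hoff (l : Fin 1) (hl : l ≠ j) (x y : Fin 1 → ℝ) : x l = y l :=
      absurd (Subsingleton.elim l j) hl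
    suffices x j = y j from funext fun l => by rwa [Subsingleton.elim l j]
    by_contra hne
    rw [← ne_eq] at hne
    rcases hfi.coordinates j with hmono | hanti | hind
    · rcases hne.lt_or_gt with hlt | hlt
      · exact (hmono x hx y hy (fun l hl => hoff l hl x y) hlt).ne hval
      · exact (hmono y hy x hx (fun l hl => hoff l hl y x) hlt).ne hval.symm
    · rcases hne.lt_or_gt with hlt | hlt
      · exact (hanti x hx y hy (fun l hl => hoff l hl x y) hlt).ne hval.symm
      · exact (hanti y hy x hx (fun l hl => hoff l hl y x) hlt).ne hval
    · exact hij hind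
  · obtain ⟨a, b, hab, hsub⟩ := exists_Ioo_subset_image hf.isSemiMonotone.isPreconnected_self
      (continuousOn_pi.1 hf.continuousOn i) hij
    obtain ⟨c, hc⟩ := nonempty_Ioo.2 hab
    refine ⟨fun _ => c, mem_interior.2 ⟨(fun w => w ⟨Sum.inr i, hi⟩) ⁻¹' Ioo a b, ?_,
      isOpen_Ioo.preimage (continuous_apply _), hc⟩⟩
    intro w hw
    obtain ⟨x, hx, hxw⟩ := hsub hw
    refine ⟨_, ⟨x, hx, rfl⟩, funext ?_⟩
    rintro ⟨a, ha⟩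
    obtain rfl := Finset.mem_singleton.1 ha
    exact hxw

theorem IsMonotoneMap.isAdmissibleMap {L : FirstOrder.Language.{u, v}} [L.Structure ℝ] {n k : ℕ}
    {X : Set (Fin n → ℝ)} {f : (Fin n → ℝ) → (Fin k → ℝ)} (hf : IsMonotoneMap L n X f) :
    IsAdmissibleMap L X f := by
  rcases n with _ | _ | n
  · exact hf.elim
  · exact hf.1
  · exact hf.1

/-- For a monotone map, the projection of the graph to the span of `n` coordinates is injective if
and only if its image has non-empty interior. -/
theorem IsMonotoneMap.injOn_restrict_iff {L : FirstOrder.Language.{u, v}} [L.Structure ℝ] {k : ℕ}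
    {n : ℕ} {X : Set (Fin n → ℝ)} {f : (Fin n → ℝ) → (Fin k → ℝ)} (hf : IsMonotoneMap L n X f)
    {H : Finset (Fin n ⊕ Fin k)} (hH : H.card = n) :
    InjOn H.restrict (mapGraph X f) ↔ (interior (H.restrict '' mapGraph X f)).Nonempty := by
  induction n with
  | zero => exact hf.elim
  | succ n ih =>
  have hadm := hf.isAdmissibleMap
  by_cases hex : ∃ i, Sum.inr i ∈ H ∧ ∃ j, ¬ IndependentOf X (fun x => f x i) j
  swap
  · push Not at hex
    exact injOn_restrict_iff_of_independentOf hadm.nonempty hadm.isSemiMonotone.isOpen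
      hadm.isSemiMonotone.isPreconnected_self hH hex
  obtain ⟨i, hi, j, hij⟩ := hex
  rcases n with _ | n
  · exact injOn_restrict_iff_of_isMonotoneFunction hadm (hf.2 i) hij hH hi
  · obtain ⟨𝓜, h𝓜⟩ := hf.2 i j hij
    have hcard : (fibreCoords i j H).card = n + 1 := by
      have := card_fibreCoords j hi
      omega
    have hfib (b : ℝ) (hb : (fibre (mapGraph X f) i j b).Nonempty) :
        (InjOn (fibreCoords i j H).restrict (fibre (mapGraph X f) i j b) ↔
          fibreCoords i j H ∈ 𝓜) ∧
        (InjOn (fibreCoords i j H).restrict (fibre (mapGraph X f) i j b) ↔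
          (interior ((fibreCoords i j H).restrict '' fibre (mapGraph X f) i j b)).Nonempty) := by
      obtain ⟨Y, g, hg, hYg, rfl⟩ := h𝓜 b hb
      rw [hYg]
      refine ⟨?_, ih hg hcard⟩
      rw [injOn_restrict_mapGraph_iff]
      exact ⟨fun h => ⟨hcard, h⟩, fun h => h.2⟩
    rw [injOn_restrict_iff_forall_fibre j hi, ← (splitCoord j hi).interior_image_nonempty]
    constructor
    · intro hinj
      obtain ⟨a, b, hab, hsub⟩ := exists_Ioo_subset_image hadm.isSemiMonotone.isPreconnected_self
        (continuousOn_pi.1 hadm.continuousOn i) hij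
      refine IsSigmaCompact.interior_nonempty_of_slices
        ((hadm.isSigmaCompact_mapGraph.image (continuous_restrict H)).image
          (splitCoord j hi).continuous) isOpen_Ioo (nonempty_Ioo.2 hab) fun c hc => ?_
      rw [slice_splitCoord_image]
      exact (hfib c (fibre_mapGraph_nonempty j (hsub hc))).2.1 (hinj c)
    · rintro ⟨⟨c, w⟩, hcw⟩
      have hslice : (interior
          ((fibreCoords i j H).restrict '' fibre (mapGraph X f) i j c)).Nonempty := by
        rw [← slice_splitCoord_image j hi]
        exact ⟨w, preimage_interior_subset_interior_preimage (Continuous.prodMk_right c) hcw⟩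
      have hc := hfib c ((hslice.mono interior_subset).of_image)
      -- Membership in `𝓜` does not mention `c`, so it passes from this fibre to every other one.
      have hmem := hc.1.1 (hc.2.2 hslice)
      intro b
      rcases (fibre (mapGraph X f) i j b).eq_empty_or_nonempty with hb | hb
      · rw [hb]
        exact injOn_empty _
      · exact (hfib b hb).1.2 hmem

theorem IsMonotoneMap.isQuasiAffine {L : FirstOrder.Language.{u, v}} [L.Structure ℝ] {n k : ℕ}
    {X : Set (Fin n → ℝ)} {f : (Fin n → ℝ) → (Fin k → ℝ)} (hf : IsMonotoneMap L n X f) :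
    IsQuasiAffine X f where
  nonempty := hf.isAdmissibleMap.nonempty
  isOpen := hf.isAdmissibleMap.isSemiMonotone.isOpen
  isBounded_domain := hf.isAdmissibleMap.isSemiMonotone.isBounded
  continuousOn := hf.isAdmissibleMap.continuousOn
  isBounded := hf.isAdmissibleMap.isBounded
  injOn_iff H hH := by
    have hn : n ≠ 0 := by
      rintro rfl
      exact hf
    have : Nonempty H := (Finset.card_pos.1 (by omega)).to_subtype
    rw [hf.injOn_restrict_iff hH, ← definableDim_eq_card_iff, Fintype.card_coe, hH]

end MonotoneMaps

theorem theorem3p14 {L : FirstOrder.Language.{u, v}} [L.Structure ℝ]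
    (hL : MonotoneMaps.IsOMinimal L) {n k : ℕ} (X : Set (Fin n → ℝ))
    (f : (Fin n → ℝ) → (Fin k → ℝ)) (hf : MonotoneMaps.IsMonotoneMap L n X f) :
    MonotoneMaps.IsQuasiAffine X f := by
  exact hf.isQuasiAffine
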